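/- All graphs are finite, simple and undirected. A graph is co-edge-regular if it is regular and there is a constant $\mu$ such that any two distinct non-adjacent vertices have exactly $\mu$ common neighbors. The spectrum of a graph is the multiset of eigenvalues of its adjacency matrix, where $\theta^{m}$ indicates that $\theta$ is repeated $m$ times. The triangular graph $T(n)$ has as vertices the $2$-subsets of an $n$-set, two of them being adjacent if and only if they have exactly one element in common. The $s$-clique extension of a graph $G$ is the graph obtained from $G$ by replacing each vertex $x$ by a clique $\widetilde X$ with $s$ vertices, where, for distinct vertices $x,y$ of $G$, every vertex of $\widetilde X$ is adjacent to every vertex of $\widetilde Y$ if $x$ and $y$ are adjacent in $G$, and no vertex of $\widetilde X$ is adjacent to a vertex of $\widetilde Y$ otherwise. Theorem. Let $s\ge 2$ and $n$ be integers with $n\ge 48s$. Let $\Gamma$ be a co-edge-regular graph with spectrum $$\left\{(2sn-3s-1)^{1},\ (sn-3s-1)^{n-1},\ (-s-1)^{\frac{n^2-3n}{2}},\ (-1)^{\frac{(s-1)n(n-1)}{2}}\right\}.$$ Then $\Gamma$ is isomorphic to the $s$-clique extension of the triangular graph $T(n)$. -/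

import Mathlib

namespace SimpleGraph

/-- A finite graph is co-edge-regular if it is regular and there is a constant `μ` such that any two
distinct non-adjacent vertices have exactly `μ` common neighbors. -/
def IsCoEdgeRegular {V : Type*} [Fintype V] [DecidableEq V] (G : SimpleGraph V)
    [DecidableRel G.Adj] : Prop :=
  (∃ k : ℕ, G.IsRegularOfDegree k) ∧
    ∃ μ : ℕ, ∀ v w : V, v ≠ w → ¬ G.Adj v w → Fintype.card (G.commonNeighbors v w) = μ

/-- The spectrum of a finite graph: the multiset of the eigenvalues of its real adjacency matrix,
each repeated according to its multiplicity. -/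
noncomputable def adjSpectrum {V : Type*} [Fintype V] [DecidableEq V] (G : SimpleGraph V)
    [DecidableRel G.Adj] : Multiset ℝ :=
  (G.adjMatrix ℝ).charpoly.roots

/-- The `s`-clique extension of `G`: every vertex `x` is replaced by the clique `{x} × Fin s`, and
vertices of the cliques of two distinct vertices `x`, `y` are adjacent iff `x`, `y` are. -/
def cliqueExtension {V : Type*} (s : ℕ) (G : SimpleGraph V) : SimpleGraph (V × Fin s) where
  Adj a b := a ≠ b ∧ (a.1 = b.1 ∨ G.Adj a.1 b.1)
  symm := ⟨fun _ _ h => ⟨h.1.symm, h.2.imp Eq.symm (fun h' => h'.symm)⟩⟩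
  loopless := ⟨fun _ h => h.1 rfl⟩

/-- The Johnson graph `J(t, d)`: the vertices are the `d`-subsets of a `t`-set, two of them being
adjacent iff they have exactly `d - 1` elements in common. -/
def johnsonGraph (t d : ℕ) : SimpleGraph {A : Finset (Fin t) // A.card = d} where
  Adj A B := (A.1 ∩ B.1).card + 1 = d
  symm := ⟨fun A B h => by rw [Finset.inter_comm]; exact h⟩
  loopless := ⟨fun A h => by
    have hA := A.2
    rw [Finset.inter_self] at h
    omega⟩

/-- The triangular graph `T(n) = J(n, 2)`. -/
abbrev triangularGraph (n : ℕ) : SimpleGraph {A : Finset (Fin n) // A.card = 2} :=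
  johnsonGraph n 2

end SimpleGraph

/-! Put `B = A + I` and `c = s²(n-3)`. The spectrum makes `B(B+s)(B-s(n-3))` a multiple of the
all-ones matrix `J` (Hoffman), which forces `μ = 4s`. Hence `T = B² - s(n-4)B - 4sJ` vanishes
outside the closed neighbourhoods, its entries on them are the excesses `|N x ∩ N y| - sn`, and `T²
= cT`, `TJ = cJ`. So the excesses around a vertex have a known sum and a known sum of squares, and
the largest eigenvalue of `T` bounds cliques. The rest is counting.

The sum of squares makes very negative excesses rare, while three pairwise non-adjacent vertices of
moderate excess from `x` cannot coexist. So `N x` is nearly covered by two large cliques, and every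
vertex lies in exactly two grand cliques (`exists_two_grand`, `grand_eq_or_eq`). Let `r` be the
number of stray neighbours of `x` and `i` the size of the intersection of its two grand cliques. The
sum of squares gives `r + i ≤ s`; the plain sum, taken at a vertex where `r` is maximal, then forces
`r = 0` and `i = s` (`eq_zero_and_eq_of_excess_bounds`). Now the intersection alone exhausts the sum
of squares, so all other excesses vanish and grand cliques have exactly `s(n-1)` vertices.

Double counting gives `n` grand cliques, any two meeting in `s` vertices. Sending a vertex to its
pair of grand cliques exhibits the clique extension of `T(n)`. -/

/-! ### Spectral facts about real symmetric matrices. -/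

open Matrix Finset in
/-- A Hermitian real matrix diagonalised entrywise. -/
theorem Matrix.IsHermitian.exists_diagonalization {V : Type*} [Fintype V] [DecidableEq V]
    {A : Matrix V V ℝ} (hA : A.IsHermitian) :
    ∃ φ : Matrix V V ℝ ≃ₐ[ℝ] Matrix V V ℝ, ∃ U : Matrix V V ℝ,
      φ (diagonal hA.eigenvalues) = A ∧
      (∀ f x y, φ (diagonal f) x y = ∑ i, U x i * f i * U y i) ∧
      ∀ X, (φ X).trace = X.trace := by
  refine ⟨(Unitary.conjStarAlgAut ℝ _ hA.eigenvectorUnitary).toAlgEquiv,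
    (hA.eigenvectorUnitary : Matrix V V ℝ), ?_, ?_, ?_⟩
  · exact hA.spectral_theorem.symm
  · intro f x y
    have h : (Unitary.conjStarAlgAut ℝ _ hA.eigenvectorUnitary).toAlgEquiv (diagonal f) =
        (hA.eigenvectorUnitary : Matrix V V ℝ) * diagonal f *
          star (hA.eigenvectorUnitary : Matrix V V ℝ) := by
      simp [Unitary.conjStarAlgAut_apply]
    rw [h, Matrix.mul_apply]
    refine Finset.sum_congr rfl fun i _ => ?_
    rw [Matrix.mul_diagonal, Matrix.star_apply, star_trivial]
  · intro X
    have h : (Unitary.conjStarAlgAut ℝ _ hA.eigenvectorUnitary).toAlgEquiv X =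
        (hA.eigenvectorUnitary : Matrix V V ℝ) * X *
          star (hA.eigenvectorUnitary : Matrix V V ℝ) := by
      simp [Unitary.conjStarAlgAut_apply]
    rw [h, Matrix.trace_mul_comm, ← Matrix.mul_assoc, Unitary.coe_star_mul_self, Matrix.one_mul]

open Matrix Finset in
theorem Matrix.IsHermitian.trace_mul_self_eq_sum {V : Type*} [Fintype V] [DecidableEq V]
    {A : Matrix V V ℝ} (hA : A.IsHermitian) :
    (A * A).trace = ∑ i, hA.eigenvalues i ^ 2 := by
  obtain ⟨φ, U, hφ, -, ht⟩ := hA.exists_diagonalization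
  have h : A * A = φ (diagonal hA.eigenvalues * diagonal hA.eigenvalues) := by rw [map_mul, hφ]
  rw [h, ht, diagonal_mul_diagonal, trace_diagonal]
  simp [sq]

open Matrix Finset in
/-- A polynomial in a symmetric matrix with constant row sums `k`, whose roots are all the
eigenvalues except one occurrence of `k`, is a multiple of the all-ones matrix. -/
theorem Matrix.IsHermitian.hoffman_cubic {V : Type*} [Fintype V] [DecidableEq V]
    {A : Matrix V V ℝ} (hA : A.IsHermitian) {k a b c : ℝ} (hrow : A *ᵥ 1 = k • 1) (i₀ : V)
    (hk : hA.eigenvalues i₀ = k) (hka : k ≠ a) (hkb : k ≠ b) (hkc : k ≠ c)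
    (hother : ∀ i, i ≠ i₀ →
      hA.eigenvalues i = a ∨ hA.eigenvalues i = b ∨ hA.eigenvalues i = c) (x y : V) :
    ((A - a • 1) * ((A - b • 1) * (A - c • 1))) x y =
      (k - a) * (k - b) * (k - c) / Fintype.card V := by
  obtain ⟨φ, U, hφ, hU, -⟩ := hA.exists_diagonalization
  have hsub : ∀ t : ℝ, A - t • 1 = φ (diagonal fun i => hA.eigenvalues i - t) := by
    intro t
    have : (diagonal fun i => hA.eigenvalues i - t) = diagonal hA.eigenvalues - t • 1 := by
      ext i j
      by_cases h : i = j
      · subst h; simp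
      · simp [h]
    rw [this, map_sub, map_smul, map_one, hφ]
  have hP : ∀ x y, ((A - a • 1) * ((A - b • 1) * (A - c • 1))) x y =
      U x i₀ * U y i₀ * ((k - a) * (k - b) * (k - c)) := by
    intro x y
    rw [hsub, hsub, hsub, ← map_mul, ← map_mul, diagonal_mul_diagonal, diagonal_mul_diagonal, hU,
      Finset.sum_eq_single i₀]
    · rw [hk]; ring
    · intro i _ hi
      rcases hother i hi with h | h | h <;> rw [h] <;> ring
    · simp
  have hne : (k - a) * (k - b) * (k - c) ≠ 0 :=
    mul_ne_zero (mul_ne_zero (sub_ne_zero.2 hka) (sub_ne_zero.2 hkb)) (sub_ne_zero.2 hkc)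
  have hrow' : ∀ t : ℝ, (A - t • 1) *ᵥ 1 = (k - t) • 1 := by
    intro t
    rw [sub_mulVec, hrow, smul_mulVec, one_mulVec, sub_smul]
  have hP1 : ((A - a • 1) * ((A - b • 1) * (A - c • 1))) *ᵥ 1 =
      ((k - a) * (k - b) * (k - c)) • 1 := by
    rw [← mulVec_mulVec, ← mulVec_mulVec, hrow', mulVec_smul, hrow', mulVec_smul, mulVec_smul,
      hrow', smul_smul, smul_smul]
    congr 1; ring
  -- The polynomial has rank one, so its constant row sums force the eigenvector `U · i₀` to be
  -- constant; no connectedness is needed.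
  have hσ : ∀ x, U x i₀ * ∑ y, U y i₀ = 1 := by
    intro x
    have h := congrFun hP1 x
    simp only [mulVec, dotProduct, Pi.one_apply, mul_one, Pi.smul_apply, smul_eq_mul] at h
    rw [Finset.sum_congr rfl fun y _ => hP x y, ← Finset.sum_mul, ← Finset.mul_sum] at h
    exact mul_right_cancel₀ hne (by rw [h, one_mul])
  have hσ2 : (∑ y, U y i₀) * ∑ y, U y i₀ = Fintype.card V := by
    rw [Finset.sum_mul, Finset.sum_congr rfl fun y _ => hσ y]
    simp
  have hN : (Fintype.card V : ℝ) ≠ 0 := by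
    have : Nonempty V := ⟨x⟩
    exact_mod_cast Fintype.card_ne_zero
  rw [hP, eq_div_iff hN, ← hσ2]
  linear_combination (k - a) * (k - b) * (k - c) * (U y i₀ * (∑ y, U y i₀) * hσ x + hσ y)

theorem Multiset.exists_eq_and_forall_ne_mem {V α : Type*} [Fintype V] [DecidableEq V]
    {f : V → α} {a : α} {m : Multiset α} (h : Multiset.map f Finset.univ.val = a ::ₘ m) :
    ∃ i, f i = a ∧ ∀ j, j ≠ i → f j ∈ m := by
  have ha : a ∈ Multiset.map f Finset.univ.val := by rw [h]; exact Multiset.mem_cons_self a m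
  obtain ⟨i, -, hi⟩ := Multiset.mem_map.1 ha
  refine ⟨i, hi, fun j hj => ?_⟩
  rw [← Multiset.cons_erase (Finset.mem_univ_val i), Multiset.map_cons, hi,
    Multiset.cons_inj_right] at h
  rw [← h]
  exact Multiset.mem_map_of_mem f ((Multiset.mem_erase_of_ne hj).2 (Finset.mem_univ_val j))

/-! ### From the spectrum to counting conditions on closed neighbourhoods. -/

/-- Local regularity conditions on the closed neighbourhoods `N x` in a co-edge-regular graph with
the spectrum of the `s`-clique extension of `T(n)`. -/
structure IsTriangularNbhd {V : Type*} [Fintype V] [DecidableEq V] (N : V → Finset V) (s n : ℕ) :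
    Prop where
  two_le : 2 ≤ s
  le_n : 48 * s ≤ n
  self_mem : ∀ x, x ∈ N x
  symm : ∀ x y, y ∈ N x → x ∈ N y
  card_univ : 2 * (Fintype.card V : ℤ) = s * n * (n - 1)
  card_nbhd : ∀ x, ((N x).card : ℤ) = s * (2 * n - 3)
  card_inter : ∀ x y, y ∉ N x → ((N x ∩ N y).card : ℤ) = 4 * s
  sum_excess : ∀ x, ∑ y ∈ N x, (((N x ∩ N y).card : ℤ) - s * n) = s * (s * (n - 3))
  sum_excess_sq :
    ∀ x, ∑ y ∈ N x, (((N x ∩ N y).card : ℤ) - s * n) ^ 2 = s * (s * (n - 3)) ^ 2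
  clique_sum : ∀ C : Finset V, (∀ x ∈ C, ∀ y ∈ C, y ∈ N x) →
    ∑ x ∈ C, ∑ y ∈ C, (((N x ∩ N y).card : ℤ) - s * n) ≤ s * (s * (n - 3)) * C.card

open Matrix Finset in
-- `T / c` is an orthogonal projection, so the Rayleigh quotient of `T` at the indicator `χ` of `C`
-- is at most `c`; expand `‖cχ - Tχ‖² ≥ 0`.
theorem Matrix.sum_sum_le_of_mul_self_eq_smul {V : Type*} [Fintype V] [DecidableEq V]
    {T : Matrix V V ℝ} {c : ℝ} (hc : 0 < c) (hT : T.IsSymm) (hTT : T * T = c • T)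
    (C : Finset V) : ∑ x ∈ C, ∑ y ∈ C, T x y ≤ c * C.card := by
  set χ : V → ℝ := fun x => if x ∈ C then 1 else 0 with hχ
  set w := T *ᵥ χ with hw
  have h1 : χ ⬝ᵥ χ = C.card := by simp [hχ, dotProduct]
  have h2 : χ ⬝ᵥ w = ∑ x ∈ C, ∑ y ∈ C, T x y := by
    simp [hχ, hw, dotProduct, mulVec, Finset.sum_ite_mem]
  have h3 : w ⬝ᵥ w = c * (χ ⬝ᵥ w) := by
    have : T *ᵥ w = c • w := by rw [hw, mulVec_mulVec, hTT, smul_mulVec]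
    calc w ⬝ᵥ w = (T *ᵥ χ) ⬝ᵥ w := rfl
      _ = χ ⬝ᵥ (T *ᵥ w) := by
        rw [dotProduct_mulVec χ, ← mulVec_transpose, hT.eq]
      _ = c * (χ ⬝ᵥ w) := by rw [this, dotProduct_smul, smul_eq_mul]
  have h4 : 0 ≤ (c • χ - w) ⬝ᵥ (c • χ - w) := by
    simp only [dotProduct]
    exact Finset.sum_nonneg fun i _ => mul_self_nonneg _
  have h5 : (c • χ - w) ⬝ᵥ (c • χ - w) = c ^ 2 * (χ ⬝ᵥ χ) - 2 * c * (χ ⬝ᵥ w) + w ⬝ᵥ w := by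
    simp only [sub_dotProduct, dotProduct_sub, smul_dotProduct, dotProduct_smul, smul_eq_mul,
      dotProduct_comm w χ]
    ring
  rw [h5, h3, h1, h2] at h4
  have h6 : 0 ≤ c * (c * C.card - ∑ x ∈ C, ∑ y ∈ C, T x y) := by linarith
  exact sub_nonneg.1 (nonneg_of_mul_nonneg_right h6 hc)

open Matrix Finset in
-- With `c = s²(n-3)`, the cubic identity says `BT = cB`, and `T` is a combination of `B²`, `B` and
-- `J`, whence `T² = cT`. The sum of squares is the diagonal of this identity, where `T x x =
-- s(n-3)`.
theorem isTriangularNbhd_of_cubic {V : Type*} [Fintype V] [DecidableEq V] {N : V → Finset V}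
    {s n : ℕ} {m : ℕ} (hs : 2 ≤ s) (hn : 48 * s ≤ n) (hself : ∀ x, x ∈ N x)
    (hsymm : ∀ x y, y ∈ N x → x ∈ N y)
    (hcard : 2 * (Fintype.card V : ℝ) = s * n * (n - 1))
    (hdeg : ∀ x, ((N x).card : ℝ) = s * (2 * n - 3))
    (hmu : ∀ x y, y ∉ N x → (N x ∩ N y).card = m)
    (B : Matrix V V ℝ) (hB : ∀ x y, B x y = if y ∈ N x then 1 else 0)
    (hcubic : B * ((B + (s : ℝ) • 1) * (B - ((s : ℝ) * (n - 3)) • 1)) =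
      (4 * (s : ℝ) ^ 2 * (2 * n - 3)) • of fun _ _ => 1) :
    IsTriangularNbhd N s n := by
  have hs' : (0 : ℝ) < s := by exact_mod_cast (by omega : 0 < s)
  have hn' : (3 : ℝ) < n := by exact_mod_cast (by omega : 3 < n)
  set J : Matrix V V ℝ := of fun _ _ => 1 with hJ
  have hiff : ∀ x y, x ∈ N y ↔ y ∈ N x := fun x y => ⟨hsymm y x, hsymm x y⟩
  have hBsymm : B.IsSymm := by
    ext x y; rw [transpose_apply, hB, hB]; simp only [hiff x y]
  have hB' : ∀ x y, B y x = if y ∈ N x then 1 else 0 := fun x y => by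
    rw [hB]; simp only [hiff x y]
  have hBB : ∀ x y, (B * B) x y = (N x ∩ N y).card := by
    intro x y
    simp only [Matrix.mul_apply, hB, hiff y, ite_mul, one_mul, zero_mul]
    rw [Finset.sum_ite_mem, Finset.univ_inter]
    simp only [Finset.sum_ite_mem, Finset.sum_const, nsmul_eq_mul, mul_one]
  have hrow : ∀ x, ∑ y, B x y = s * (2 * n - 3) := by
    intro x; rw [← hdeg x]; simp [hB]
  have hBJ : B * J = ((s : ℝ) * (2 * n - 3)) • J := by
    ext x y; simp [Matrix.mul_apply, hJ, hrow x]
  have hB3 : B * (B * B) = ((s : ℝ) * (n - 4)) • (B * B) + ((s : ℝ) ^ 2 * (n - 3)) • B +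
      (4 * (s : ℝ) ^ 2 * (2 * n - 3)) • J := by
    rw [← hcubic]
    simp only [mul_add, mul_sub, add_mul, Matrix.mul_smul, Matrix.smul_mul, mul_one, one_mul]
    module
  -- the diagonal of the cubic identity determines the number of common neighbours
  have hm : ∀ x y, y ∉ N x → (m : ℝ) = 4 * s := by
    intro x y hxy
    have h1 : ∑ z, (B * B) x z = (s * (2 * n - 3)) * (s * (2 * n - 3)) := by
      have := congrFun (congrFun (show (B * B) * J = _ by
        rw [mul_assoc, hBJ, Matrix.mul_smul, hBJ, smul_smul]) x) y
      simpa [Matrix.mul_apply, hJ] using this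
    have h2 : ∑ z ∈ N x, (B * B) x z =
        s * (n - 4) * (s * (2 * n - 3)) + s ^ 2 * (n - 3) + 4 * s ^ 2 * (2 * n - 3) := by
      have h := congrFun (congrFun hB3 x) x
      rw [← mul_assoc, mul_apply] at h
      simp only [hB', mul_ite, mul_one, mul_zero, Finset.sum_ite_mem, Finset.univ_inter,
        Matrix.add_apply, Matrix.smul_apply, hBB x x, Finset.inter_self, hdeg, hself, if_true, hJ, of_apply,
        smul_eq_mul] at h
      exact h
    have h3 : ∑ z ∈ (N x)ᶜ, (B * B) x z = ((N x)ᶜ.card : ℝ) * m := by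
      rw [Finset.sum_congr rfl fun z hz => ?_, Finset.sum_const, nsmul_eq_mul]
      rw [hBB, hmu x z (Finset.mem_compl.1 hz)]
    have h4 : ((N x)ᶜ.card : ℝ) = Fintype.card V - s * (2 * n - 3) := by
      rw [Finset.card_compl, Nat.cast_sub (Finset.card_le_univ _), hdeg]
    rw [← Finset.sum_add_sum_compl (N x), h2, h3, h4] at h1
    -- This is twice the number of vertices outside `N x`.
    have h5 : (s : ℝ) * (n - 2) * (n - 3) ≠ 0 := by
      have : (n : ℝ) - 2 ≠ 0 := by linarith
      have : (n : ℝ) - 3 ≠ 0 := by linarith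
      positivity
    apply mul_left_cancel₀ h5
    linear_combination 2 * h1 - (m : ℝ) * hcard
  set T : Matrix V V ℝ := B * B - ((s : ℝ) * (n - 4)) • B - (4 * (s : ℝ)) • J with hT
  have hTe : ∀ x y, T x y = if y ∈ N x then ((N x ∩ N y).card : ℝ) - s * n else 0 := by
    intro x y
    rw [hT, Matrix.sub_apply, Matrix.sub_apply, Matrix.smul_apply, Matrix.smul_apply, hBB, hB]
    split_ifs with h
    · simp [hJ]; ring
    · rw [hmu x y h, hm x y h]; simp [hJ]
  have hBT : B * T = ((s : ℝ) * (s * (n - 3))) • B := by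
    rw [hT, mul_sub, mul_sub, hB3, Matrix.mul_smul, Matrix.mul_smul, hBJ]
    module
  have hJJ : J * J = (Fintype.card V : ℝ) • J := by
    ext x y; simp [hJ, mul_apply]
  have hTJ : T * J = ((s : ℝ) * (s * (n - 3))) • J := by
    rw [hT, sub_mul, sub_mul, mul_assoc, hBJ, Matrix.mul_smul, hBJ, Matrix.smul_mul, hBJ,
      Matrix.smul_mul, hJJ, smul_smul, smul_smul, smul_smul, ← sub_smul, ← sub_smul]
    congr 1
    linear_combination (-2 * (s : ℝ)) * hcard
  have hTs : T.IsSymm := by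
    rw [hT, IsSymm, transpose_sub, transpose_sub, transpose_mul, transpose_smul, transpose_smul,
      hBsymm.eq]
    rfl
  have hJT : J * T = ((s : ℝ) * (s * (n - 3))) • J := by
    have := congrArg transpose hTJ
    rwa [transpose_mul, hTs.eq, transpose_smul, show Jᵀ = J from rfl] at this
  have hTT : T * T = ((s : ℝ) * (s * (n - 3))) • T := by
    nth_rewrite 1 [hT]
    rw [sub_mul, sub_mul, mul_assoc, hBT, Matrix.mul_smul, Matrix.smul_mul, hBT, Matrix.smul_mul,
      hJT, hT]
    module
  refine ⟨hs, hn, hself, hsymm, by exact_mod_cast hcard, fun x => by exact_mod_cast hdeg x,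
    fun x y h => ?_, fun x => ?_, fun x => ?_, fun C hC => ?_⟩
  · have := hm x y h
    rw [hmu x y h]; exact_mod_cast this
  · have h := congrFun (congrFun hTJ x) x
    simp only [mul_apply, hTe, hJ, of_apply, mul_one, Finset.sum_ite_mem, Finset.univ_inter,
      Matrix.smul_apply, smul_eq_mul] at h
    exact_mod_cast h
  · have h := congrFun (congrFun hTT x) x
    rw [mul_apply, Finset.sum_congr rfl fun y _ => by rw [← hTs.apply y x]] at h
    simp only [hTe, ite_mul, zero_mul, Finset.sum_ite_mem, Finset.univ_inter, Matrix.smul_apply,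
      hself, if_true, Finset.inter_self, hdeg, smul_eq_mul] at h
    have h' : ∑ y ∈ N x, (((N x ∩ N y).card : ℝ) - s * n) ^ 2 = s * (s * (n - 3)) ^ 2 := by
      rw [Finset.sum_congr rfl fun y hy => ?_, h]
      · ring
      · rw [if_pos hy, sq]
    exact_mod_cast h'
  · have h := Matrix.sum_sum_le_of_mul_self_eq_smul (T := T)
      (c := (s : ℝ) * (s * (n - 3))) (by have := sub_pos.2 hn'; positivity) hTs hTT C
    rw [Finset.sum_congr rfl fun x hx => Finset.sum_congr rfl fun y hy => by
      rw [hTe, if_pos (hC x hx y hy)]] at h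
    exact_mod_cast h

namespace SimpleGraph

variable {V : Type*} [Fintype V] [DecidableEq V] (Γ : SimpleGraph V) [DecidableRel Γ.Adj]

/-- The closed neighbourhood of a vertex, as a finset. -/
def closedNbhd (x : V) : Finset V := insert x (Γ.neighborFinset x)

theorem mem_closedNbhd {x y : V} : y ∈ Γ.closedNbhd x ↔ y = x ∨ Γ.Adj x y := by
  simp [closedNbhd]

theorem card_closedNbhd (x : V) : (Γ.closedNbhd x).card = Γ.degree x + 1 := by
  rw [closedNbhd, Finset.card_insert_of_notMem (by simp), card_neighborFinset_eq_degree]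

theorem closedNbhd_inter_card {x y : V} (h : y ∉ Γ.closedNbhd x) :
    (Γ.closedNbhd x ∩ Γ.closedNbhd y).card = Fintype.card (Γ.commonNeighbors x y) := by
  rw [mem_closedNbhd, not_or] at h
  rw [← Set.toFinset_card]
  congr 1
  ext z
  simp only [Finset.mem_inter, mem_closedNbhd, Set.mem_toFinset, mem_commonNeighbors]
  constructor
  · rintro ⟨rfl | h1, rfl | h2⟩
    · exact absurd rfl h.1
    · exact absurd h2.symm h.2
    · exact absurd h1 h.2
    · exact ⟨h1, h2⟩
  · exact fun ⟨h1, h2⟩ => ⟨.inr h1, .inr h2⟩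

open Matrix Finset in
theorem isTriangularNbhd_closedNbhd (s n : ℕ) (hs : 2 ≤ s) (hn : 48 * s ≤ n)
    (hco : Γ.IsCoEdgeRegular)
    (hspec : Γ.adjSpectrum =
      Multiset.replicate 1 (2 * (s : ℝ) * n - 3 * s - 1) +
      Multiset.replicate (n - 1) ((s : ℝ) * n - 3 * s - 1) +
      Multiset.replicate ((n ^ 2 - 3 * n) / 2) (-(s : ℝ) - 1) +
      Multiset.replicate ((s - 1) * n * (n - 1) / 2) (-1 : ℝ)) :
    IsTriangularNbhd Γ.closedNbhd s n := by
  obtain ⟨⟨k, hk⟩, m, hm⟩ := hco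
  have hA : (Γ.adjMatrix ℝ).IsHermitian := by
    rw [IsHermitian, conjTranspose_eq_transpose_of_trivial, transpose_adjMatrix]
  rw [adjSpectrum, hA.roots_charpoly_eq_eigenvalues] at hspec
  have hspec' : Multiset.map hA.eigenvalues univ.val = _ := hspec
  have hm1 : (((n - 1 : ℕ) : ℝ)) = n - 1 := by
    rw [Nat.cast_sub (by omega), Nat.cast_one]
  have hm2 : (((n ^ 2 - 3 * n) / 2 : ℕ) : ℝ) = (n ^ 2 - 3 * n) / 2 := by
    obtain ⟨a, rfl⟩ : ∃ a, n = a + 3 := ⟨n - 3, by omega⟩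
    have he : (a + 3) ^ 2 - 3 * (a + 3) = a * (a + 1) + 2 * a := by
      rw [Nat.sub_eq_iff_eq_add (by nlinarith)]; ring
    rw [he, Nat.cast_div ((Nat.even_mul_succ_self a).add (even_two_mul a)).two_dvd (by norm_num)]
    push_cast; ring
  have hm3 : (((s - 1) * n * (n - 1) / 2 : ℕ) : ℝ) = (s - 1) * n * (n - 1) / 2 := by
    rw [Nat.cast_div]
    · rw [Nat.cast_mul, Nat.cast_mul, hm1, Nat.cast_sub (by omega)]; norm_num
    · rw [mul_assoc]; exact (Nat.even_mul_pred_self n).two_dvd.mul_left _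
    · norm_num
  have hcard : 2 * (Fintype.card V : ℝ) = s * n * (n - 1) := by
    have h := congrArg (fun M => ((Multiset.card M : ℕ) : ℝ)) hspec'
    simp only [Multiset.card_map, card_val, card_univ, Multiset.card_add, Multiset.card_replicate,
      Nat.cast_add, hm1, hm2, hm3] at h
    rw [h]; push_cast; ring
  -- The degree is read off from the trace of `A²`, so it need not be identified with the largest
  -- eigenvalue beforehand.
  have htr : (Fintype.card V : ℝ) * k = (2 * (s : ℝ) * n - 3 * s - 1) ^ 2 +
      (n - 1) * ((s : ℝ) * n - 3 * s - 1) ^ 2 + (n ^ 2 - 3 * n) / 2 * (-(s : ℝ) - 1) ^ 2 +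
      (s - 1) * n * (n - 1) / 2 := by
    have h := hA.trace_mul_self_eq_sum
    have h' := congrArg (fun M => (Multiset.map (fun t : ℝ => t ^ 2) M).sum) hspec'
    simp only [Multiset.map_map, Multiset.map_add, Multiset.map_replicate, Multiset.sum_add,
      Multiset.sum_replicate, nsmul_eq_mul, hm1, hm2, hm3] at h'
    have h'' : ∑ i, hA.eigenvalues i ^ 2 =
      (Multiset.map ((fun t : ℝ => t ^ 2) ∘ hA.eigenvalues) univ.val).sum := rfl
    rw [h'', h'] at h
    have htrk : (Γ.adjMatrix ℝ * Γ.adjMatrix ℝ).trace = (Fintype.card V : ℝ) * k := by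
      simp only [trace, diag_apply, adjMatrix_mul_self_apply_self, hk.degree_eq, sum_const,
        card_univ, nsmul_eq_mul]
    rw [← htrk, h]; norm_num
  have hs' : (2 : ℝ) ≤ s := by exact_mod_cast hs
  have hn' : (4 : ℝ) ≤ n := by exact_mod_cast (by omega : 4 ≤ n)
  have hk' : (k : ℝ) = 2 * (s : ℝ) * n - 3 * s - 1 := by
    have h0 : (s : ℝ) * n * (n - 1) ≠ 0 := by
      have : (0 : ℝ) < n - 1 := by linarith
      positivity
    apply mul_left_cancel₀ h0
    linear_combination 2 * htr - (k : ℝ) * hcard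
  rw [Multiset.replicate_one, add_assoc, add_assoc, Multiset.singleton_add] at hspec'
  obtain ⟨i₀, hi₀, hother⟩ := Multiset.exists_eq_and_forall_ne_mem hspec'
  have hrow : Γ.adjMatrix ℝ *ᵥ 1 = (2 * (s : ℝ) * n - 3 * s - 1) • 1 := by
    ext x
    rw [← hk']
    have := adjMatrix_mulVec_const_apply_of_regular (α := ℝ) (a := 1) hk (v := x)
    simpa [Pi.one_def] using this
  have hcubic := hA.hoffman_cubic (a := -1) (b := -(s : ℝ) - 1) (c := (s : ℝ) * n - 3 * s - 1)
    hrow i₀ hi₀ (by nlinarith) (by nlinarith) (by nlinarith) (fun i hi => by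
      have h := hother i hi
      simp only [Multiset.mem_add, Multiset.mem_replicate] at h
      tauto)
  have hsymm : ∀ x y, y ∈ Γ.closedNbhd x → x ∈ Γ.closedNbhd y := by
    intro x y
    rw [mem_closedNbhd, mem_closedNbhd, eq_comm, Γ.adj_comm]
    exact id
  refine isTriangularNbhd_of_cubic (m := m) hs hn
    (fun x => Γ.mem_closedNbhd.2 (.inl rfl)) hsymm hcard (fun x => ?_) (fun x y h => ?_)
    (Γ.adjMatrix ℝ + 1) (fun x y => ?_) ?_
  · rw [card_closedNbhd, hk.degree_eq]; push_cast; rw [hk']; ring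
  · rw [Γ.closedNbhd_inter_card h]
    rw [mem_closedNbhd, not_or] at h
    exact hm x y (Ne.symm h.1) h.2
  · rw [Matrix.add_apply, adjMatrix_apply, Matrix.one_apply]
    simp only [mem_closedNbhd]
    by_cases h : x = y
    · subst h; simp
    · simp [h, Ne.symm h]
  · ext x y
    have h := hcubic x y
    have e1 : Γ.adjMatrix ℝ - (-1 : ℝ) • 1 = Γ.adjMatrix ℝ + 1 := by module
    have e2 : Γ.adjMatrix ℝ - (-(s : ℝ) - 1) • 1 = Γ.adjMatrix ℝ + 1 + (s : ℝ) • 1 := by module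
    have e3 : Γ.adjMatrix ℝ - ((s : ℝ) * n - 3 * s - 1) • 1 =
        Γ.adjMatrix ℝ + 1 - ((s : ℝ) * (n - 3)) • 1 := by module
    rw [e1, e2, e3] at h
    rw [h]
    have h0 : (Fintype.card V : ℝ) ≠ 0 := by
      have : Nonempty V := ⟨x⟩
      exact_mod_cast Fintype.card_ne_zero
    simp only [Matrix.smul_apply, of_apply, smul_eq_mul, mul_one]
    rw [div_eq_iff h0]
    linear_combination (-2 * (s : ℝ) ^ 2 * (2 * n - 3)) * hcard

end SimpleGraph

/-! ### Grand cliques: exactly two through each vertex. -/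

namespace Finset

theorem card_add_card_add_card_le {α : Type*} [DecidableEq α] {U A B C : Finset α} (hA : A ⊆ U)
    (hB : B ⊆ U) (hC : C ⊆ U) :
    A.card + B.card + C.card ≤ U.card + (A ∩ B).card + (A ∩ C).card + (B ∩ C).card := by
  have h1 := card_union_add_card_inter A B
  have h2 := card_union_add_card_inter (A ∪ B) C
  have h3 : ((A ∪ B) ∩ C).card ≤ (A ∩ C).card + (B ∩ C).card := by
    rw [union_inter_distrib_right]; exact card_union_le _ _
  have h4 : ((A ∪ B) ∪ C).card ≤ U.card := card_le_card (union_subset (union_subset hA hB) hC)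
  omega

end Finset

section

variable {V : Type*} [Fintype V] [DecidableEq V]

/-- The number of common closed neighbours of `x` and `y`, minus `s * n`. -/
def nbhdExcess (N : V → Finset V) (s n : ℕ) (x y : V) : ℤ := ((N x ∩ N y).card : ℤ) - s * n

/-- A set of vertices which are pairwise equal or adjacent. -/
def IsNbhdClique (N : V → Finset V) (C : Finset V) : Prop := ∀ x ∈ C, ∀ y ∈ C, y ∈ N x

/-- A maximal clique which is large. -/
structure IsGrandClique (N : V → Finset V) (s n : ℕ) (C : Finset V) : Prop where
  clique : IsNbhdClique N C
  maximal : ∀ z, (∀ b ∈ C, b ∈ N z) → z ∈ C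
  le_card : (s : ℤ) * (n - 24) ≤ C.card

theorem IsGrandClique.eq_of_subset {V : Type*} {N : V → Finset V} {s n : ℕ} {C D : Finset V}
    (hC : IsGrandClique N s n C) (hD : IsGrandClique N s n D) (hCD : C ⊆ D) : C = D :=
  hCD.antisymm fun z hz => hC.maximal z fun b hb => hD.clique z hz b (hCD hb)

namespace IsTriangularNbhd

variable {N : V → Finset V} {s n : ℕ}

theorem two_le_cast (h : IsTriangularNbhd N s n) : (2 : ℤ) ≤ s := by exact_mod_cast h.two_le

theorem le_n_cast (h : IsTriangularNbhd N s n) : 48 * (s : ℤ) ≤ n := by exact_mod_cast h.le_n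

theorem le_mul_cast (h : IsTriangularNbhd N s n) : 96 * (s : ℤ) ≤ s * n := by
  nlinarith [h.two_le_cast, h.le_n_cast]

theorem mem_comm (h : IsTriangularNbhd N s n) {x y : V} : x ∈ N y ↔ y ∈ N x :=
  ⟨h.symm y x, h.symm x y⟩

theorem card_mul_sq_le (h : IsTriangularNbhd N s n) {x : V} {A : Finset V} (hA : A ⊆ N x) {m : ℤ}
    (hm : ∀ y ∈ A, m ^ 2 ≤ nbhdExcess N s n x y ^ 2) :
    (A.card : ℤ) * m ^ 2 ≤ s * (s * (n - 3)) ^ 2 := by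
  rw [← h.sum_excess_sq x, ← nsmul_eq_mul]
  exact (Finset.card_nsmul_le_sum A _ _ hm).trans
    (Finset.sum_le_sum_of_subset_of_nonneg hA fun i _ _ => sq_nonneg _)

/-- Two members of a clique have at least `|C|` common closed neighbours, so `clique_sum` yields
`|C|(|C| - sn) ≤ s²(n-3)`. -/
theorem card_clique_le (h : IsTriangularNbhd N s n) {C : Finset V} (hC : IsNbhdClique N C) :
    (C.card : ℤ) ≤ s * (n + 1) := by
  have h1 := h.clique_sum C hC
  have h2 : (C.card : ℤ) * (C.card * (C.card - s * n)) ≤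
      ∑ x ∈ C, ∑ y ∈ C, (((N x ∩ N y).card : ℤ) - s * n) := by
    rw [← nsmul_eq_mul]
    refine Finset.card_nsmul_le_sum _ _ _ fun x hx => ?_
    rw [← nsmul_eq_mul]
    refine Finset.card_nsmul_le_sum _ _ _ fun y hy => ?_
    have : C ⊆ N x ∩ N y := fun z hz => Finset.mem_inter.2 ⟨hC x hx z hz, hC y hy z hz⟩
    have := Finset.card_le_card this
    have : (C.card : ℤ) ≤ (N x ∩ N y).card := by exact_mod_cast this
    linarith
  by_contra! hlt
  have hs := h.two_le_cast
  have hn := h.le_n_cast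
  have hpos : (0 : ℤ) < C.card := lt_of_le_of_lt (by positivity) hlt
  have h3 : (C.card : ℤ) * (C.card - s * n) ≤ s * (s * (n - 3)) := by
    refine le_of_mul_le_mul_left ?_ hpos
    linarith
  nlinarith

/-- Each `N x ∩ N yᵢ` has at least about `3sn/4` elements and they overlap pairwise in at most `4s`,
too much for the `s(2n-3)` elements of `N x`. -/
theorem no_claw (h : IsTriangularNbhd N s n) {x y₁ y₂ y₃ : V}
    (h₁ : -((s : ℤ) * (n - 3)) ≤ 4 * nbhdExcess N s n x y₁)
    (h₂ : -((s : ℤ) * (n - 3)) ≤ 4 * nbhdExcess N s n x y₂)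
    (h₃ : -((s : ℤ) * (n - 3)) ≤ 4 * nbhdExcess N s n x y₃)
    (h₁₂ : y₂ ∉ N y₁) (h₁₃ : y₃ ∉ N y₁) (h₂₃ : y₃ ∉ N y₂) : False := by
  have key := Finset.card_add_card_add_card_le (U := N x) (A := N x ∩ N y₁) (B := N x ∩ N y₂)
    (C := N x ∩ N y₃) Finset.inter_subset_left Finset.inter_subset_left Finset.inter_subset_left
  have hle : ∀ a b : V, b ∉ N a → ((((N x ∩ N a) ∩ (N x ∩ N b)).card : ℕ) : ℤ) ≤ 4 * s := by
    intro a b hab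
    rw [← h.card_inter a b hab]
    exact_mod_cast Finset.card_le_card
      (Finset.inter_subset_inter Finset.inter_subset_right Finset.inter_subset_right)
  have e1 := hle _ _ h₁₂
  have e2 := hle _ _ h₁₃
  have e3 := hle _ _ h₂₃
  have hd := h.card_nbhd x
  have hs := h.two_le_cast
  have hsn := h.le_mul_cast
  simp only [nbhdExcess] at h₁ h₂ h₃
  zify at key
  linarith

theorem exists_grand_superset (h : IsTriangularNbhd N s n) {C : Finset V} (hC : IsNbhdClique N C)
    (hcard : (s : ℤ) * (n - 24) ≤ C.card) : ∃ D, C ⊆ D ∧ IsGrandClique N s n D := by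
  obtain ⟨D, hCD, hD⟩ := Finite.exists_le_maximal hC
  refine ⟨D, hCD, hD.1, fun z hz => ?_, hcard.trans (by exact_mod_cast Finset.card_le_card hCD)⟩
  have hins : IsNbhdClique N (insert z D) := by
    intro a ha b hb
    rcases Finset.mem_insert.1 ha with rfl | ha' <;> rcases Finset.mem_insert.1 hb with rfl | hb'
    · exact h.self_mem _
    · exact hz b hb'
    · exact h.symm _ _ (hz a ha')
    · exact hD.1 a ha' b hb'
  exact hD.2 hins (Finset.subset_insert z D) (Finset.mem_insert_self z D)

/-- By maximality `z` misses some `b ∈ C`, and `N z ∩ C ⊆ N z ∩ N b`. -/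
theorem card_nbhd_inter_grand_le (h : IsTriangularNbhd N s n) {C : Finset V}
    (hC : IsGrandClique N s n C) {z : V} (hz : z ∉ C) : ((N z ∩ C).card : ℤ) ≤ 4 * s := by
  have : ¬ ∀ b ∈ C, b ∈ N z := fun hb => hz (hC.maximal z hb)
  push Not at this
  obtain ⟨b, hb, hbz⟩ := this
  rw [← h.card_inter z b hbz]
  exact_mod_cast Finset.card_le_card
    (Finset.inter_subset_inter_left fun y hy => hC.clique b hb y hy)

theorem card_grand_inter_le_four (h : IsTriangularNbhd N s n) {C D : Finset V}
    (hC : IsGrandClique N s n C) (hD : IsGrandClique N s n D) (hCD : C ≠ D) :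
    ((C ∩ D).card : ℤ) ≤ 4 * s := by
  have : ¬ C ⊆ D := fun hsub => hCD (hC.eq_of_subset hD hsub)
  obtain ⟨a, haC, haD⟩ := Finset.not_subset.1 this
  refine le_trans ?_ (h.card_nbhd_inter_grand_le hD haD)
  exact_mod_cast Finset.card_le_card
    (Finset.inter_subset_inter_right fun y hy => hC.clique a haC y hy)

/-- Three grand cliques through `x` would need `3s(n-24) ≤ s(2n-3) + 12s`, contrary to `n ≥ 96`. -/
theorem grand_eq_or_eq (h : IsTriangularNbhd N s n) {C D E : Finset V}
    (hC : IsGrandClique N s n C) (hD : IsGrandClique N s n D) (hE : IsGrandClique N s n E)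
    (hCD : C ≠ D) {x : V} (hxC : x ∈ C) (hxD : x ∈ D) (hxE : x ∈ E) : E = C ∨ E = D := by
  by_contra! hne
  have key := Finset.card_add_card_add_card_le (hC.clique x hxC) (hD.clique x hxD)
    (hE.clique x hxE)
  have e1 := h.card_grand_inter_le_four hC hD hCD
  have e2 := h.card_grand_inter_le_four hC hE hne.1.symm
  have e3 := h.card_grand_inter_le_four hD hE hne.2.symm
  have hd := h.card_nbhd x
  have hs := h.two_le_cast
  have hsn := h.le_mul_cast
  have c1 := hC.le_card
  have c2 := hD.le_card
  have c3 := hE.le_card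
  zify at key
  linarith

theorem exists_two_grand (h : IsTriangularNbhd N s n) (x : V) :
    ∃ C D, IsGrandClique N s n C ∧ IsGrandClique N s n D ∧ C ≠ D ∧ x ∈ C ∧ x ∈ D := by
  have hs := h.two_le_cast
  have hn := h.le_n_cast
  have hsn := h.le_mul_cast
  have hd := h.card_nbhd x
  set P : V → Prop := fun y => -((s : ℤ) * (n - 3)) ≤ 4 * nbhdExcess N s n x y with hP
  set G := (N x).filter P with hG
  -- Each vertex outside `G` contributes more than `(s(n-3))²/16` to a sum of squares equal to
  -- `s(s(n-3))²`, so there are at most `16s` of them.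
  have hGcard : (s : ℤ) * (2 * n - 3) - 16 * s ≤ G.card := by
    have h1 : ((((N x).filter fun y => ¬ P y).card : ℕ) : ℤ) * (s * (n - 3)) ^ 2 ≤
        16 * s * (s * (n - 3)) ^ 2 := by
      have hpos : (0 : ℤ) ≤ s * (n - 3) := by linarith
      have h2 : ∀ y ∈ (N x).filter fun y => ¬ P y,
          ((s : ℤ) * (n - 3)) ^ 2 ≤ 16 * nbhdExcess N s n x y ^ 2 := by
        intro y hy
        have := (Finset.mem_filter.1 hy).2
        simp only [hP, not_le] at this
        nlinarith
      calc _ ≤ ∑ y ∈ (N x).filter fun y => ¬ P y, 16 * nbhdExcess N s n x y ^ 2 := by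
            rw [← nsmul_eq_mul]; exact Finset.card_nsmul_le_sum _ _ _ h2
        _ ≤ ∑ y ∈ N x, 16 * nbhdExcess N s n x y ^ 2 :=
            Finset.sum_le_sum_of_subset_of_nonneg (Finset.filter_subset _ _)
              fun i _ _ => by positivity
        _ = 16 * s * (s * (n - 3)) ^ 2 := by
            rw [← Finset.mul_sum]
            have := h.sum_excess_sq x
            simp only [nbhdExcess]
            rw [this]; ring
    have h3 : (0 : ℤ) < (s * (n - 3)) ^ 2 := by
      have : (0 : ℤ) < s * (n - 3) := by linarith
      positivity
    have h4 := le_of_mul_le_mul_right h1 h3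
    have h5 := Finset.card_filter_add_card_filter_not (s := N x) P
    zify at h5
    linarith
  have hGP : ∀ y ∈ G, P y := fun y hy => (Finset.mem_filter.1 hy).2
  have hGN : ∀ y ∈ G, y ∈ N x := fun y hy => (Finset.mem_filter.1 hy).1
  obtain ⟨y, hy, z, hz, hyz⟩ : ∃ y ∈ G, ∃ z ∈ G, z ∉ N y := by
    by_contra! hcon
    have := h.card_clique_le (C := G) hcon
    linarith
  have hzy : y ∉ N z := fun hmem => hyz (h.symm _ _ hmem)
  have hclique : ∀ a ∈ G, IsNbhdClique N (insert x (G \ N a)) := by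
    intro a ha u hu v hv
    rcases Finset.mem_insert.1 hu with rfl | hu <;> rcases Finset.mem_insert.1 hv with rfl | hv
    · exact h.self_mem _
    · exact hGN v (Finset.mem_sdiff.1 hv).1
    · exact h.symm _ _ (hGN u (Finset.mem_sdiff.1 hu).1)
    · rw [Finset.mem_sdiff] at hu hv
      by_contra huv
      exact h.no_claw (hGP a ha) (hGP u hu.1) (hGP v hv.1) hu.2 hv.2 huv
  -- Both cliques have at most `s(n+1)` vertices and their sizes add up to at least `s(2n-23)`;
  -- hence the threshold `s(n-24)` for grand cliques.
  have hsum : (s : ℤ) * (2 * n - 3) - 20 * s ≤ (G \ N z).card + (G \ N y).card := by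
    have h1 : G ⊆ (G \ N z) ∪ (G \ N y) ∪ (N y ∩ N z) := by
      intro w hw
      simp only [Finset.mem_union, Finset.mem_sdiff, Finset.mem_inter, hw, true_and]
      tauto
    have h2 := (Finset.card_le_card h1).trans
      ((Finset.card_union_le _ _).trans (Nat.add_le_add_right (Finset.card_union_le _ _) _))
    have h3 := h.card_inter y z hyz
    zify at h2
    linarith
  have hle : ∀ a ∈ G, ((G \ N a).card : ℤ) ≤ (insert x (G \ N a)).card := fun a _ => by
    exact_mod_cast Finset.card_le_card (Finset.subset_insert _ _)
  have hy1 := hle y hy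
  have hz1 := hle z hz
  have hy2 := h.card_clique_le (hclique y hy)
  have hz2 := h.card_clique_le (hclique z hz)
  obtain ⟨C, hCs, hC⟩ := h.exists_grand_superset (hclique z hz) (by linarith)
  obtain ⟨D, hDs, hD⟩ := h.exists_grand_superset (hclique y hy) (by linarith)
  refine ⟨C, D, hC, hD, ?_, hCs (Finset.mem_insert_self _ _), hDs (Finset.mem_insert_self _ _)⟩
  rintro rfl
  exact hyz (hC.clique y (hCs (Finset.mem_insert_of_mem (Finset.mem_sdiff.2 ⟨hy, hzy⟩))) z
    (hDs (Finset.mem_insert_of_mem (Finset.mem_sdiff.2 ⟨hz, hyz⟩))))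

end IsTriangularNbhd

end

/-! ### Stray neighbours and their elimination. -/

section

open Classical in
/-- The neighbours of `x` which share no grand clique with `x`. -/
noncomputable def strayNbhd {V : Type*} (N : V → Finset V) (s n : ℕ) (x : V) : Finset V :=
  (N x).filter fun y => ∀ C, IsGrandClique N s n C → x ∈ C → y ∉ C

theorem strayNbhd_subset {V : Type*} {N : V → Finset V} {s n : ℕ} (x : V) :
    strayNbhd N s n x ⊆ N x := by
  classical exact Finset.filter_subset _ _

namespace IsTriangularNbhd

variable {V : Type*} [Fintype V] [DecidableEq V] {N : V → Finset V} {s n : ℕ} {C D : Finset V} {x : V}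

theorem strayNbhd_eq (h : IsTriangularNbhd N s n) (hC : IsGrandClique N s n C)
    (hD : IsGrandClique N s n D) (hCD : C ≠ D) (hxC : x ∈ C) (hxD : x ∈ D) :
    strayNbhd N s n x = N x \ (C ∪ D) := by
  ext y
  simp only [strayNbhd, Finset.mem_filter, Finset.mem_sdiff, Finset.mem_union, not_or]
  refine and_congr_right fun _ => ⟨fun hy => ⟨hy C hC hxC, hy D hD hxD⟩, fun hy E hE hxE => ?_⟩
  rcases h.grand_eq_or_eq hC hD hE hCD hxC hxD hxE with rfl | rfl
  · exact hy.1
  · exact hy.2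

theorem mem_or_mem_or_mem_strayNbhd (h : IsTriangularNbhd N s n) (hC : IsGrandClique N s n C)
    (hD : IsGrandClique N s n D) (hCD : C ≠ D) (hxC : x ∈ C) (hxD : x ∈ D) {w : V}
    (hw : w ∈ N x) : w ∈ C ∨ w ∈ D ∨ w ∈ strayNbhd N s n x := by
  rw [h.strayNbhd_eq hC hD hCD hxC hxD]
  simp only [Finset.mem_sdiff, Finset.mem_union, hw, true_and]
  tauto

theorem card_add_card_eq (h : IsTriangularNbhd N s n) (hC : IsGrandClique N s n C)
    (hD : IsGrandClique N s n D) (hCD : C ≠ D) (hxC : x ∈ C) (hxD : x ∈ D) :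
    (C.card : ℤ) + D.card = s * (2 * n - 3) + (C ∩ D).card - (strayNbhd N s n x).card := by
  have h1 := Finset.card_sdiff_add_card_eq_card
    (Finset.union_subset (hC.clique x hxC) (hD.clique x hxD))
  rw [← h.strayNbhd_eq hC hD hCD hxC hxD] at h1
  have h2 := Finset.card_union_add_card_inter C D
  have h3 := h.card_nbhd x
  zify at h1 h2
  linarith

/-- A stray neighbour sees at most `4s` vertices of each grand clique through `x`; its other common
neighbours with `x` are stray. -/
theorem card_inter_stray_le (h : IsTriangularNbhd N s n) (hC : IsGrandClique N s n C)
    (hD : IsGrandClique N s n D) (hCD : C ≠ D) (hxC : x ∈ C) (hxD : x ∈ D) {y : V}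
    (hy : y ∈ strayNbhd N s n x) :
    ((N x ∩ N y).card : ℤ) ≤ 8 * s + (strayNbhd N s n x).card := by
  have hy' := hy
  rw [h.strayNbhd_eq hC hD hCD hxC hxD, Finset.mem_sdiff, Finset.mem_union, not_or] at hy'
  have h1 : N x ∩ N y ⊆ (N y ∩ C) ∪ (N y ∩ D) ∪ strayNbhd N s n x := by
    intro w hw
    rw [Finset.mem_inter] at hw
    have := h.mem_or_mem_or_mem_strayNbhd hC hD hCD hxC hxD hw.1
    simp only [Finset.mem_union, Finset.mem_inter, hw.2, true_and]
    tauto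
  have h2 := (Finset.card_le_card h1).trans
      ((Finset.card_union_le _ _).trans (Nat.add_le_add_right (Finset.card_union_le _ _) _))
  have h3 := h.card_nbhd_inter_grand_le hC hy'.2.1
  have h4 := h.card_nbhd_inter_grand_le hD hy'.2.2
  zify at h2
  linarith

theorem le_card_inter_of_mem_inter (h : IsTriangularNbhd N s n) (hC : IsGrandClique N s n C)
    (hD : IsGrandClique N s n D) (hCD : C ≠ D) (hxC : x ∈ C) (hxD : x ∈ D) {y : V}
    (hy : y ∈ C ∩ D) :
    (s : ℤ) * (2 * n - 3) - (strayNbhd N s n x).card ≤ (N x ∩ N y).card := by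
  rw [Finset.mem_inter] at hy
  have h1 : C ∪ D ⊆ N x ∩ N y := Finset.union_subset
    (fun w hw => Finset.mem_inter.2 ⟨hC.clique x hxC w hw, hC.clique y hy.1 w hw⟩)
    (fun w hw => Finset.mem_inter.2 ⟨hD.clique x hxD w hw, hD.clique y hy.2 w hw⟩)
  have h2 := Finset.card_le_card h1
  have h3 := Finset.card_union_add_card_inter C D
  have h4 := h.card_add_card_eq hC hD hCD hxC hxD
  zify at h2 h3
  linarith

/-- A bootstrap: the clique sizes give the crude bound `49s`, so stray excesses are at most
`-s(n-57)` (`57 = 8 + 49`), and the sum of squares then improves the bound, since `6(n-57)² >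
(n-3)²` for `n ≥ 96`. -/
theorem card_stray_le_six (h : IsTriangularNbhd N s n) (x : V) :
    ((strayNbhd N s n x).card : ℤ) ≤ 6 * s := by
  obtain ⟨C, D, hC, hD, hCD, hxC, hxD⟩ := h.exists_two_grand x
  have hs := h.two_le_cast
  have hn := h.le_n_cast
  have hsn := h.le_mul_cast
  have h1 : ((strayNbhd N s n x).card : ℤ) ≤ 49 * s := by
    have := h.card_add_card_eq hC hD hCD hxC hxD
    have := h.card_grand_inter_le_four hC hD hCD
    have := hC.le_card
    have := hD.le_card
    linarith
  have h2 := h.card_mul_sq_le (x := x) (A := strayNbhd N s n x) (strayNbhd_subset x)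
    (m := s * (n - 57)) (fun y hy => by
      have := h.card_inter_stray_le hC hD hCD hxC hxD hy
      have h57 : nbhdExcess N s n x y ≤ -(s * (n - 57)) := by
        simp only [nbhdExcess]; linarith
      nlinarith)
  by_contra! hlt
  have hs2 : (0 : ℤ) < s ^ 2 := by positivity
  have h3 : ((strayNbhd N s n x).card : ℤ) * (n - 57) ^ 2 ≤ s * (n - 3) ^ 2 := by
    refine le_of_mul_le_mul_left ?_ hs2
    linarith
  have h4 : (6 * (s : ℤ)) * (n - 57) ^ 2 ≤ s * (n - 3) ^ 2 :=
    (mul_le_mul_of_nonneg_right hlt.le (sq_nonneg _)).trans h3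
  have h5 : 6 * ((n : ℤ) - 57) ^ 2 ≤ (n - 3) ^ 2 := by
    refine le_of_mul_le_mul_left ?_ (by linarith : (0 : ℤ) < s)
    linarith
  nlinarith

theorem card_stray_add_card_inter_le (h : IsTriangularNbhd N s n) (hC : IsGrandClique N s n C)
    (hD : IsGrandClique N s n D) (hCD : C ≠ D) (hxC : x ∈ C) (hxD : x ∈ D) :
    ((strayNbhd N s n x).card : ℤ) + (C ∩ D).card ≤ s := by
  have hs := h.two_le_cast
  have hn := h.le_n_cast
  have hsn := h.le_mul_cast
  have h6 := h.card_stray_le_six x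
  have hdisj : Disjoint (strayNbhd N s n x) (C ∩ D) := by
    rw [h.strayNbhd_eq hC hD hCD hxC hxD]
    exact Finset.sdiff_disjoint.mono_right
      (Finset.inter_subset_left.trans Finset.subset_union_left)
  -- Stray excesses are now at most `-s(n-14)` (`14 = 8 + 6`), and those on `C ∩ D` are at least
  -- `s(n-9)`.
  have h2 := h.card_mul_sq_le (x := x) (A := strayNbhd N s n x ∪ (C ∩ D))
    (Finset.union_subset (strayNbhd_subset x)
      (Finset.inter_subset_left.trans (hC.clique x hxC)))
    (m := s * (n - 14)) (fun y hy => by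
      rcases Finset.mem_union.1 hy with hy | hy
      · have := h.card_inter_stray_le hC hD hCD hxC hxD hy
        have h14 : nbhdExcess N s n x y ≤ -(s * (n - 14)) := by
          simp only [nbhdExcess]; linarith
        nlinarith
      · have := h.le_card_inter_of_mem_inter hC hD hCD hxC hxD hy
        have h14 : s * (n - 14) ≤ nbhdExcess N s n x y := by
          simp only [nbhdExcess]; linarith
        nlinarith)
  rw [Finset.card_union_of_disjoint hdisj] at h2
  push_cast at h2
  by_contra! hlt
  have hs2 : (0 : ℤ) < s ^ 2 := by positivity
  have h3 : (((strayNbhd N s n x).card : ℤ) + (C ∩ D).card) * (n - 14) ^ 2 ≤ s * (n - 3) ^ 2 := by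
    refine le_of_mul_le_mul_left ?_ hs2
    linarith
  have h4 : ((s : ℤ) + 1) * (n - 14) ^ 2 ≤ s * (n - 3) ^ 2 :=
    (mul_le_mul_of_nonneg_right hlt (sq_nonneg _)).trans h3
  nlinarith

theorem card_grand_inter_le (h : IsTriangularNbhd N s n) (hC : IsGrandClique N s n C)
    (hD : IsGrandClique N s n D) (hCD : C ≠ D) : ((C ∩ D).card : ℤ) ≤ s := by
  rcases (C ∩ D).eq_empty_or_nonempty with he | ⟨x, hx⟩
  · rw [he]; simp
  · rw [Finset.mem_inter] at hx
    have := h.card_stray_add_card_inter_le hC hD hCD hx.1 hx.2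
    linarith

theorem exists_other_grand (h : IsTriangularNbhd N s n) (C : Finset V) (x : V) :
    ∃ D, IsGrandClique N s n D ∧ C ≠ D ∧ x ∈ D := by
  obtain ⟨D, E, hD, hE, hDE, hxD, hxE⟩ := h.exists_two_grand x
  by_cases hCD : C = D
  · exact ⟨E, hE, hCD ▸ hDE, hxE⟩
  · exact ⟨D, hD, hCD, hxD⟩

/-- A common neighbour outside `C` and stray for neither vertex lies in `D` and in the second grand
clique of `y`; these are distinct, so they share at most `s` vertices. -/
theorem card_inter_le_of_mem_sdiff (h : IsTriangularNbhd N s n) (hC : IsGrandClique N s n C)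
    (hD : IsGrandClique N s n D) (hCD : C ≠ D) (hxC : x ∈ C) (hxD : x ∈ D) {y : V}
    (hy : y ∈ C \ D) :
    ((N x ∩ N y).card : ℤ) ≤
      C.card + s + (strayNbhd N s n x ∩ N y).card + (strayNbhd N s n y).card := by
  rw [Finset.mem_sdiff] at hy
  obtain ⟨E, hE, hCE, hyE⟩ := h.exists_other_grand C y
  have hDE : D ≠ E := fun he => hy.2 (he ▸ hyE)
  have h1 : N x ∩ N y ⊆ C ∪ (D ∩ E) ∪ (strayNbhd N s n x ∩ N y) ∪ strayNbhd N s n y := by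
    intro w hw
    rw [Finset.mem_inter] at hw
    have e1 := h.mem_or_mem_or_mem_strayNbhd hC hD hCD hxC hxD hw.1
    have e2 := h.mem_or_mem_or_mem_strayNbhd hC hE hCE hy.1 hyE hw.2
    simp only [Finset.mem_union, Finset.mem_inter, hw.2, and_true]
    tauto
  have h2 := Finset.card_le_card h1
  have h3 := Finset.card_union_le (C ∪ (D ∩ E) ∪ (strayNbhd N s n x ∩ N y)) (strayNbhd N s n y)
  have h4 := Finset.card_union_le (C ∪ (D ∩ E)) (strayNbhd N s n x ∩ N y)
  have h5 := Finset.card_union_le C (D ∩ E)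
  have h6 := h.card_grand_inter_le hD hE hDE
  zify at h2 h3 h4 h5
  linarith

/-- The last term comes from double counting adjacent pairs between stray neighbours of `x` and `C \
D`. -/
theorem sum_excess_sdiff_le (h : IsTriangularNbhd N s n) (hC : IsGrandClique N s n C)
    (hD : IsGrandClique N s n D) (hCD : C ≠ D) (hxC : x ∈ C) (hxD : x ∈ D) {r : ℤ}
    (hr : ∀ y, ((strayNbhd N s n y).card : ℤ) ≤ r) :
    ∑ y ∈ C \ D, nbhdExcess N s n x y ≤
      ((C.card : ℤ) - (C ∩ D).card) * (C.card + s - s * n + r) +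
        4 * s * (strayNbhd N s n x).card := by
  have h1 : ∑ y ∈ C \ D, ((strayNbhd N s n x ∩ N y).card : ℤ) ≤
      4 * s * (strayNbhd N s n x).card := by
    have e1 : ∀ y, ((strayNbhd N s n x ∩ N y).card : ℤ) =
        ∑ w ∈ strayNbhd N s n x, if w ∈ N y then 1 else 0 := by
      intro y; rw [← Finset.sum_filter, Finset.filter_mem_eq_inter]; simp
    rw [Finset.sum_congr rfl fun y _ => e1 y, Finset.sum_comm, mul_comm (4 * (s : ℤ)),
      ← nsmul_eq_mul]
    refine Finset.sum_le_card_nsmul _ _ _ fun w hw => ?_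
    rw [h.strayNbhd_eq hC hD hCD hxC hxD, Finset.mem_sdiff, Finset.mem_union, not_or] at hw
    refine le_trans ?_ (h.card_nbhd_inter_grand_le hC hw.2.1)
    simp only [h.mem_comm (x := w)]
    rw [← Finset.sum_filter, Finset.filter_mem_eq_inter, Finset.sum_const, nsmul_eq_mul, mul_one]
    rw [Finset.inter_comm]
    exact_mod_cast Finset.card_le_card (Finset.inter_subset_inter_left Finset.sdiff_subset)
  have h2 : ((C \ D).card : ℤ) = C.card - (C ∩ D).card := by
    have := Finset.card_sdiff_add_card_inter C D
    zify at this
    linarith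
  calc ∑ y ∈ C \ D, nbhdExcess N s n x y
      ≤ ∑ y ∈ C \ D, (((C.card : ℤ) + s - s * n + r) + (strayNbhd N s n x ∩ N y).card) := by
        refine Finset.sum_le_sum fun y hy => ?_
        have := h.card_inter_le_of_mem_sdiff hC hD hCD hxC hxD hy
        have := hr y
        simp only [nbhdExcess]
        linarith
    _ ≤ _ := by
        rw [Finset.sum_add_distrib, Finset.sum_const, nsmul_eq_mul, h2]
        linarith

theorem sum_excess_split (h : IsTriangularNbhd N s n) (hC : IsGrandClique N s n C)
    (hD : IsGrandClique N s n D) (hCD : C ≠ D) (hxC : x ∈ C) (hxD : x ∈ D) (f : V → ℤ) :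
    ∑ y ∈ N x, f y = ∑ y ∈ strayNbhd N s n x, f y + ∑ y ∈ C ∩ D, f y + ∑ y ∈ C \ D, f y +
      ∑ y ∈ D \ C, f y := by
  rw [← Finset.sum_sdiff (Finset.union_subset (hC.clique x hxC) (hD.clique x hxD)),
    ← h.strayNbhd_eq hC hD hCD hxC hxD, ← Finset.sum_sdiff (Finset.subset_union_left (s₂ := D)),
    Finset.union_sdiff_left, ← Finset.sum_inter_add_sum_sdiff C D]
  ring

theorem excess_le (h : IsTriangularNbhd N s n) (x y : V) :
    nbhdExcess N s n x y ≤ s * (n - 3) := by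
  have h1 := Finset.card_le_card (Finset.inter_subset_left (s₁ := N x) (s₂ := N y))
  have h2 := h.card_nbhd x
  zify at h1
  simp only [nbhdExcess]
  linarith

/-- In terms of the deviations `g`, `u`, `v` from the expected values `s`, `s(n-1)`, `s(n-1)` of
`i`, `c`, `d`, the four bounds add up to an inequality whose dominant term is `-2gs(n-3)`; this is
impossible unless `g = 0`. -/
theorem eq_zero_and_eq_of_excess_bounds {s n r i c d a₁ a₂ a₃ a₄ : ℤ} (hs : 2 ≤ s)
    (hn : 48 * s ≤ n) (hr : 0 ≤ r) (hi : 0 ≤ i) (hri : r + i ≤ s)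
    (hcd : c + d = s * (2 * n - 3) + i - r) (hc : c ≤ s * (n + 1)) (hd : d ≤ s * (n + 1))
    (hsum : a₁ + a₂ + a₃ + a₄ = s * (s * (n - 3))) (h₁ : a₁ ≤ r * (9 * s - s * n))
    (h₂ : a₂ ≤ i * (s * (n - 3))) (h₃ : a₃ ≤ (c - i) * (c + s - s * n + r) + 4 * s * r)
    (h₄ : a₄ ≤ (d - i) * (d + s - s * n + r) + 4 * s * r) : r = 0 ∧ i = s := by
  obtain ⟨g, rfl⟩ : ∃ g : ℤ, i = s - g := ⟨s - i, by ring⟩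
  obtain ⟨u, rfl⟩ : ∃ u : ℤ, c = s * (n - 1) - u := ⟨s * (n - 1) - c, by ring⟩
  obtain ⟨v, rfl⟩ : ∃ v : ℤ, d = s * (n - 1) - v := ⟨s * (n - 1) - d, by ring⟩
  have huv : r = u + v - g := by linarith
  have hu : -(2 * s) ≤ u := by linarith
  have hv : -(2 * s) ≤ v := by linarith
  have hrg : r ≤ g := by linarith
  have main : 0 ≤ -2 * g * (s * (n - 3)) + 15 * s * r - s * g - g ^ 2 - r ^ 2 + u ^ 2 + v ^ 2 := by
    subst huv
    linarith
  rcases (hr.trans hrg).eq_or_lt with hg | hg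
  · constructor <;> linarith
  · exfalso
    have h5 : u ^ 2 + v ^ 2 ≤ 20 * s ^ 2 := by
      have : 0 ≤ (u + 2 * s) * (v + 2 * s) := mul_nonneg (by linarith) (by linarith)
      have : (u + v) ^ 2 ≤ (2 * s) ^ 2 := by
        refine pow_le_pow_left₀ (by linarith) (by linarith) 2
      have : s * (u + v) ≤ s * (2 * s) := mul_le_mul_of_nonneg_left (by linarith) (by linarith)
      linarith
    have h6 : s * r ≤ s * g := mul_le_mul_of_nonneg_left hrg (by linarith)
    have h7 : s * (48 * s) ≤ s * n := mul_le_mul_of_nonneg_left hn (by linarith)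
    -- Integrality gives `g ≥ 1`, so the linear term in `g` outweighs `u² + v² ≤ 20s²`.
    have h8 : 0 ≤ (g - 1) * (2 * (s * (n - 3)) - 16 * s) := by
      refine mul_nonneg (by linarith) ?_
      nlinarith
    nlinarith [mul_pos (by linarith : 0 < s) hg, sq_nonneg g, sq_nonneg r]

theorem stray_eq_zero_and_inter_eq_of_max (h : IsTriangularNbhd N s n)
    (hC : IsGrandClique N s n C) (hD : IsGrandClique N s n D) (hCD : C ≠ D) (hxC : x ∈ C)
    (hxD : x ∈ D) (hr : ∀ y, (strayNbhd N s n y).card ≤ (strayNbhd N s n x).card) :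
    (strayNbhd N s n x).card = 0 ∧ (C ∩ D).card = s := by
  have hr' : ∀ y, ((strayNbhd N s n y).card : ℤ) ≤ (strayNbhd N s n x).card := fun y => by
    exact_mod_cast hr y
  have hs := h.two_le_cast
  have hn := h.le_n_cast
  have hsn := h.le_mul_cast
  have hsum := h.sum_excess x
  rw [h.sum_excess_split hC hD hCD hxC hxD] at hsum
  have e1 := h.sum_excess_sdiff_le hC hD hCD hxC hxD hr'
  have e2 := h.sum_excess_sdiff_le hD hC hCD.symm hxD hxC hr'
  have hri := h.card_stray_add_card_inter_le hC hD hCD hxC hxD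
  have e3 : ∑ y ∈ C ∩ D, nbhdExcess N s n x y ≤ (C ∩ D).card * (s * (n - 3)) := by
    rw [← nsmul_eq_mul]
    exact Finset.sum_le_card_nsmul _ _ _ fun y _ => h.excess_le x y
  have e4 : ∑ y ∈ strayNbhd N s n x, nbhdExcess N s n x y ≤
      (strayNbhd N s n x).card * (9 * s - s * n) := by
    rw [← nsmul_eq_mul]
    refine Finset.sum_le_card_nsmul _ _ _ fun y hy => ?_
    have := h.card_inter_stray_le hC hD hCD hxC hxD hy
    simp only [nbhdExcess]
    linarith
  have hcd := h.card_add_card_eq hC hD hCD hxC hxD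
  rw [Finset.inter_comm D C] at e2
  simp only [nbhdExcess] at e1 e2 e3 e4
  have hfin := eq_zero_and_eq_of_excess_bounds hs hn (Nat.cast_nonneg _) (Nat.cast_nonneg _) hri
    hcd (h.card_clique_le hC.clique) (h.card_clique_le hD.clique) hsum e4 e3 e1 e2
  exact_mod_cast hfin

theorem strayNbhd_eq_empty (h : IsTriangularNbhd N s n) (x : V) : strayNbhd N s n x = ∅ := by
  obtain ⟨z, -, hz⟩ := Finset.exists_max_image Finset.univ
    (fun y => (strayNbhd N s n y).card) ⟨x, Finset.mem_univ x⟩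
  obtain ⟨C, D, hC, hD, hCD, hzC, hzD⟩ := h.exists_two_grand z
  have h0 := (h.stray_eq_zero_and_inter_eq_of_max hC hD hCD hzC hzD
    fun y => hz y (Finset.mem_univ y)).1
  have := hz x (Finset.mem_univ x)
  rw [← Finset.card_eq_zero]
  omega

/-! ### Exact sizes of grand cliques and of their intersections. -/

theorem card_grand_inter_eq (h : IsTriangularNbhd N s n) (hC : IsGrandClique N s n C)
    (hD : IsGrandClique N s n D) (hCD : C ≠ D) (hxC : x ∈ C) (hxD : x ∈ D) :
    (C ∩ D).card = s := by
  refine (h.stray_eq_zero_and_inter_eq_of_max hC hD hCD hxC hxD fun y => ?_).2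
  rw [h.strayNbhd_eq_empty, h.strayNbhd_eq_empty]

/-- The `s` vertices of `C ∩ D` have the full excess `s(n-3)` and already use up the whole sum of
squares. -/
theorem excess_eq_zero_of_mem_sdiff (h : IsTriangularNbhd N s n) (hC : IsGrandClique N s n C)
    (hD : IsGrandClique N s n D) (hCD : C ≠ D) (hxC : x ∈ C) (hxD : x ∈ D) {y : V}
    (hy : y ∈ C \ D) : nbhdExcess N s n x y = 0 := by
  have hsq := h.sum_excess_sq x
  rw [h.sum_excess_split hC hD hCD hxC hxD, h.strayNbhd_eq_empty] at hsq
  have e1 : ∑ y ∈ C ∩ D, (((N x ∩ N y).card : ℤ) - s * n) ^ 2 = s * (s * (n - 3)) ^ 2 := by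
    rw [Finset.sum_congr rfl fun y hy => ?_, Finset.sum_const,
      h.card_grand_inter_eq hC hD hCD hxC hxD, nsmul_eq_mul]
    have h1 := h.le_card_inter_of_mem_inter hC hD hCD hxC hxD hy
    rw [h.strayNbhd_eq_empty, Finset.card_empty] at h1
    have h2 := h.excess_le x y
    simp only [nbhdExcess] at h2
    congr 1
    push_cast at h1
    linarith
  have e2 : 0 ≤ ∑ y ∈ D \ C, (((N x ∩ N y).card : ℤ) - s * n) ^ 2 :=
    Finset.sum_nonneg fun _ _ => sq_nonneg _
  have e3 : nbhdExcess N s n x y ^ 2 ≤ ∑ y ∈ C \ D, (((N x ∩ N y).card : ℤ) - s * n) ^ 2 :=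
    Finset.single_le_sum (f := fun y => (((N x ∩ N y).card : ℤ) - s * n) ^ 2)
      (fun _ _ => sq_nonneg _) hy
  rw [e1, Finset.sum_empty] at hsq
  exact pow_eq_zero_iff (two_ne_zero) |>.1 (le_antisymm (by linarith) (sq_nonneg _))

/-- For `y ∈ C \ D` there are `sn` common neighbours, all but at most `s` of them in `C`. -/
theorem le_card_grand (h : IsTriangularNbhd N s n) (hC : IsGrandClique N s n C)
    (hD : IsGrandClique N s n D) (hCD : C ≠ D) (hxC : x ∈ C) (hxD : x ∈ D) :
    (s : ℤ) * (n - 1) ≤ C.card := by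
  have hs := h.two_le_cast
  have hsn := h.le_mul_cast
  have hne : ¬ C ⊆ D := fun hsub => hCD (hC.eq_of_subset hD hsub)
  obtain ⟨y, hyC, hyD⟩ := Finset.not_subset.1 hne
  have hy := Finset.mem_sdiff.2 ⟨hyC, hyD⟩
  have h1 := h.excess_eq_zero_of_mem_sdiff hC hD hCD hxC hxD hy
  have h2 := h.card_inter_le_of_mem_sdiff hC hD hCD hxC hxD hy
  rw [h.strayNbhd_eq_empty, h.strayNbhd_eq_empty, Finset.empty_inter, Finset.card_empty] at h2
  simp only [nbhdExcess] at h1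
  push_cast at h2
  linarith

theorem card_grand_eq (h : IsTriangularNbhd N s n) (hC : IsGrandClique N s n C) :
    (C.card : ℤ) = s * (n - 1) := by
  have hs := h.two_le_cast
  have hsn := h.le_mul_cast
  have hpos : 0 < C.card := by
    have := hC.le_card
    zify
    linarith
  obtain ⟨x, hxC⟩ := Finset.card_pos.1 hpos
  obtain ⟨D, hD, hCD, hxD⟩ := h.exists_other_grand C x
  have h1 := h.le_card_grand hC hD hCD hxC hxD
  have h2 := h.le_card_grand hD hC hCD.symm hxD hxC
  have h3 := h.card_add_card_eq hC hD hCD hxC hxD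
  rw [h.strayNbhd_eq_empty, h.card_grand_inter_eq hC hD hCD hxC hxD, Finset.card_empty] at h3
  push_cast at h3
  linarith

end IsTriangularNbhd

end

/-! ### Reconstruction of the clique extension. -/

theorem Equiv.exists_prod_fin_of_card_fiber {V T : Type*} [Fintype V] [DecidableEq T] {s : ℕ}
    (f : V → T) (hf : ∀ t, (Finset.univ.filter fun x => f x = t).card = s) :
    ∃ e : V ≃ T × Fin s, ∀ x, (e x).1 = f x := by
  have hfib : ∀ t, Nonempty ({x // f x = t} ≃ Fin s) := fun t =>
    ⟨Fintype.equivFinOfCardEq (by rw [Fintype.card_subtype, hf t])⟩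
  let g := fun t => (hfib t).some
  exact ⟨(Equiv.sigmaFiberEquiv f).symm.trans
    ((Equiv.sigmaCongrRight g).trans (Equiv.sigmaEquivProd T (Fin s))), fun x => rfl⟩

namespace IsTriangularNbhd

variable {V : Type*} [Fintype V] [DecidableEq V] {N : V → Finset V} {s n : ℕ}

open Classical in
theorem card_filter_grand_mem (h : IsTriangularNbhd N s n) (x : V) :
    (Finset.univ.filter fun C => IsGrandClique N s n C ∧ x ∈ C).card = 2 := by
  obtain ⟨C, D, hC, hD, hCD, hxC, hxD⟩ := h.exists_two_grand x
  rw [← Finset.card_pair hCD]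
  congr 1
  ext E
  simp only [Finset.mem_filter, Finset.mem_univ, true_and, Finset.mem_insert,
    Finset.mem_singleton]
  constructor
  · exact fun hE => h.grand_eq_or_eq hC hD hE.1 hCD hxC hxD hE.2
  · rintro (rfl | rfl)
    exacts [⟨hC, hxC⟩, ⟨hD, hxD⟩]

open Classical in
theorem card_filter_grand (h : IsTriangularNbhd N s n) :
    (Finset.univ.filter (IsGrandClique N s n)).card = n := by
  have hs := h.two_le_cast
  have hn := h.le_n_cast
  have h1 : ∑ C ∈ Finset.univ.filter (IsGrandClique N s n), (C.card : ℤ) =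
      2 * Fintype.card V := by
    have e1 : ∀ C : Finset V, (C.card : ℤ) = ∑ x : V, if x ∈ C then 1 else 0 := by
      intro C; simp
    rw [Finset.sum_congr rfl fun C _ => e1 C, Finset.sum_comm,
      Finset.sum_congr rfl fun x _ => ?_, Finset.sum_const, Finset.card_univ, nsmul_eq_mul,
      mul_comm]
    rw [← Finset.sum_filter, Finset.filter_filter, Finset.sum_const, nsmul_eq_mul, mul_one,
      h.card_filter_grand_mem x]
    rfl
  rw [Finset.sum_congr rfl fun C hC => h.card_grand_eq (Finset.mem_filter.1 hC).2,
    Finset.sum_const, nsmul_eq_mul, h.card_univ] at h1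
  have h2 : (s : ℤ) * (n - 1) ≠ 0 := mul_ne_zero (by linarith) (by linarith)
  have h3 : ((Finset.univ.filter (IsGrandClique N s n)).card : ℤ) = n :=
    mul_right_cancel₀ h2 (by rw [h1]; ring)
  exact_mod_cast h3

theorem exists_grand_enumeration (h : IsTriangularNbhd N s n) :
    ∃ K : Fin n → Finset V, Function.Injective K ∧ (∀ i, IsGrandClique N s n (K i)) ∧
      ∀ C, IsGrandClique N s n C → ∃ i, K i = C := by
  classical
  let e := Finset.equivFinOfCardEq h.card_filter_grand
  refine ⟨fun i => (e.symm i).1, Subtype.val_injective.comp e.symm.injective,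
    fun i => (Finset.mem_filter.1 (e.symm i).2).2, fun C hC => ?_⟩
  exact ⟨e ⟨C, Finset.mem_filter.2 ⟨Finset.mem_univ _, hC⟩⟩, by simp⟩

variable {K : Fin n → Finset V}

theorem card_filter_mem_eq_two (h : IsTriangularNbhd N s n) (hK : Function.Injective K)
    (hg : ∀ i, IsGrandClique N s n (K i)) (hall : ∀ C, IsGrandClique N s n C → ∃ i, K i = C)
    (x : V) : (Finset.univ.filter fun i => x ∈ K i).card = 2 := by
  classical
  rw [← h.card_filter_grand_mem x, ← Finset.card_map ⟨K, hK⟩]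
  congr 1
  ext C
  simp only [Finset.mem_map, Finset.mem_filter, Finset.mem_univ, true_and,
    Function.Embedding.coeFn_mk]
  constructor
  · rintro ⟨i, hi, rfl⟩; exact ⟨hg i, hi⟩
  · rintro ⟨hC, hx⟩
    obtain ⟨i, rfl⟩ := hall C hC
    exact ⟨i, hx, rfl⟩

/-- The `n - 1` intersections with `K i` have at most `s` elements each and add up to `|K i| =
s(n-1)`, so each bound is attained. This also shows that any two grand cliques do meet. -/
theorem card_inter_enumeration (h : IsTriangularNbhd N s n) (hK : Function.Injective K)
    (hg : ∀ i, IsGrandClique N s n (K i)) (hall : ∀ C, IsGrandClique N s n C → ∃ i, K i = C)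
    {i j : Fin n} (hij : i ≠ j) : (K i ∩ K j).card = s := by
  have hle : ∀ k ∈ Finset.univ.erase i, (K i ∩ K k).card ≤ s := fun k hk => by
    exact_mod_cast h.card_grand_inter_le (hg i) (hg k) (hK.ne (Finset.ne_of_mem_erase hk).symm)
  have hsum : ∑ k ∈ Finset.univ.erase i, (K i ∩ K k).card = ∑ k ∈ Finset.univ.erase i, s := by
    have e1 : ∀ k, (K i ∩ K k).card = ∑ x ∈ K i, if x ∈ K k then 1 else 0 := by
      intro k; rw [← Finset.sum_filter, Finset.filter_mem_eq_inter]; simp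
    rw [Finset.sum_congr rfl fun k _ => e1 k, Finset.sum_comm,
      Finset.sum_congr rfl fun x hx => ?_, Finset.sum_const, Finset.sum_const,
      Finset.card_erase_of_mem (Finset.mem_univ i), Finset.card_univ, Fintype.card_fin]
    -- The constant `1` counts the grand cliques other than `K i` through a vertex of `K i`.
    rotate_left
    · exact 1
    · rw [← Finset.sum_filter, Finset.sum_const, Finset.filter_erase,
        Finset.card_erase_of_mem (by simpa using hx), h.card_filter_mem_eq_two hK hg hall x]
      rfl
    · have hpos : 1 ≤ n := by have := h.two_le; have := h.le_n; omega
      have := h.card_grand_eq (hg i)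
      zify [hpos]
      simp only [smul_eq_mul, Nat.cast_mul, Nat.cast_sub hpos, Nat.cast_one, mul_one]
      rw [this]; ring
  exact (Finset.sum_eq_sum_iff_of_le hle).1 hsum j
    (Finset.mem_erase.2 ⟨hij.symm, Finset.mem_univ j⟩)

theorem mem_nbhd_iff_exists (h : IsTriangularNbhd N s n)
    (hg : ∀ i, IsGrandClique N s n (K i)) (hall : ∀ C, IsGrandClique N s n C → ∃ i, K i = C)
    (x y : V) : y ∈ N x ↔ ∃ i, x ∈ K i ∧ y ∈ K i := by
  constructor
  · intro hy
    obtain ⟨C, D, hC, hD, hCD, hxC, hxD⟩ := h.exists_two_grand x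
    obtain ⟨i, rfl⟩ := hall C hC
    obtain ⟨j, rfl⟩ := hall D hD
    have := h.mem_or_mem_or_mem_strayNbhd hC hD hCD hxC hxD hy
    rw [h.strayNbhd_eq_empty] at this
    rcases this with hy | hy | hy
    · exact ⟨i, hxC, hy⟩
    · exact ⟨j, hxD, hy⟩
    · simp at hy
  · rintro ⟨i, hx, hy⟩
    exact (hg i).clique x hx y hy

end IsTriangularNbhd

theorem Finset.inter_nonempty_iff_of_card_eq_two {α : Type*} [DecidableEq α] {A B : Finset α}
    (hA : A.card = 2) (hB : B.card = 2) :
    (A ∩ B).Nonempty ↔ A = B ∨ (A ∩ B).card + 1 = 2 := by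
  constructor
  · intro hne
    have h1 := hne.card_pos
    have h2 : (A ∩ B).card ≤ 2 := hA ▸ card_le_card inter_subset_left
    rcases (show (A ∩ B).card = 1 ∨ (A ∩ B).card = 2 by omega) with h | h
    · exact .inr (by omega)
    · have e1 := eq_of_subset_of_card_le (inter_subset_left (s₁ := A) (s₂ := B)) (by omega)
      have e2 := eq_of_subset_of_card_le (inter_subset_right (s₁ := A) (s₂ := B)) (by omega)
      exact .inl (e1.symm.trans e2)
  · rintro (rfl | h)
    · rw [inter_self, ← card_pos]; omega
    · rw [← card_pos]; omega

theorem SimpleGraph.nonempty_iso_cliqueExtension_triangularGraph {V : Type*} [Fintype V]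
    [DecidableEq V] (Γ : SimpleGraph V) [DecidableRel Γ.Adj] {s n : ℕ}
    (h : IsTriangularNbhd Γ.closedNbhd s n) :
    Nonempty (Γ ≃g SimpleGraph.cliqueExtension s (SimpleGraph.triangularGraph n)) := by
  obtain ⟨K, hK, hg, hall⟩ := h.exists_grand_enumeration
  let f : V → {A : Finset (Fin n) // A.card = 2} := fun x =>
    ⟨Finset.univ.filter fun i => x ∈ K i, h.card_filter_mem_eq_two hK hg hall x⟩
  have hmem : ∀ x i, i ∈ (f x).1 ↔ x ∈ K i := fun x i => by simp [f]
  -- Since a vertex lies in exactly two grand cliques, the fibre over `{i, j}` is `K i ∩ K j`.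
  have hfib : ∀ A, (Finset.univ.filter fun x => f x = A).card = s := by
    rintro ⟨A, hA⟩
    obtain ⟨i, j, hij, rfl⟩ := Finset.card_eq_two.1 hA
    rw [← h.card_inter_enumeration hK hg hall hij]
    congr 1
    ext x
    simp only [Finset.mem_filter, Finset.mem_univ, true_and, Finset.mem_inter]
    rw [← hmem, ← hmem, Subtype.ext_iff]
    constructor
    · intro hx; simp [hx]
    · intro hx
      refine (Finset.eq_of_subset_of_card_le (Finset.insert_subset hx.1
        (Finset.singleton_subset_iff.2 hx.2)) ?_).symm
      rw [hA, (f x).2]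
  obtain ⟨e, he⟩ := Equiv.exists_prod_fin_of_card_fiber f hfib
  refine ⟨⟨e, fun {x y} => ?_⟩⟩
  have h1 : Γ.Adj x y ↔ x ≠ y ∧ y ∈ Γ.closedNbhd x := by
    rw [Γ.mem_closedNbhd]
    exact ⟨fun ha => ⟨ha.ne, .inr ha⟩, fun ha => ha.2.resolve_left ha.1.symm⟩
  have h2 : (∃ i, x ∈ K i ∧ y ∈ K i) ↔ ((f x).1 ∩ (f y).1).Nonempty := by
    simp only [Finset.Nonempty, Finset.mem_inter, hmem]
  rw [h1, h.mem_nbhd_iff_exists hg hall, h2,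
    Finset.inter_nonempty_iff_of_card_eq_two (f x).2 (f y).2, ← Subtype.ext_iff, ← he, ← he,
    ← e.injective.ne_iff]
  rfl

theorem theorem1 {V : Type*} [Fintype V] [DecidableEq V] (Γ : SimpleGraph V) [DecidableRel Γ.Adj]
    (s n : ℕ) (hs : 2 ≤ s) (hn : 48 * s ≤ n)
    (hco : Γ.IsCoEdgeRegular)
    (hspec : Γ.adjSpectrum =
      Multiset.replicate 1 (2 * (s : ℝ) * n - 3 * s - 1) +
      Multiset.replicate (n - 1) ((s : ℝ) * n - 3 * s - 1) +
      Multiset.replicate ((n ^ 2 - 3 * n) / 2) (-(s : ℝ) - 1) +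
      Multiset.replicate ((s - 1) * n * (n - 1) / 2) (-1 : ℝ)) :
    Nonempty (Γ ≃g SimpleGraph.cliqueExtension s (SimpleGraph.triangularGraph n)) :=
  Γ.nonempty_iso_cliqueExtension_triangularGraph
    (Γ.isTriangularNbhd_closedNbhd s n hs hn hco hspec)
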